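/- Let $M\ge 0$ be an integer, let $D>0$ and $k=2\pi/D$. Let $\mathbf A,\mathbf B\in\mathbb R^{(M+1)\times(M+1)}$ be the matrices with indices $0,\dots,M$ whose only nonzero entries are $A_{i,i-1}=A_{i-1,i}=\sqrt i$ and $B_{i,i-1}=\sqrt i$ for $1\le i\le M$. Let $\mathbf H=\mathrm{diag}(h_0,\dots,h_M)$ be a real diagonal matrix (the filter) with $h_i\le 0$ for all $i$, $h_0=0$ and $h_M<0$. For $m\in\mathbb Z$ put $\mathbf A_m=-\imath mk\mathbf A+\mathbf H$. Let $\mathscr H=\ell^2(\mathbb Z;\mathbb C^{M+1})$ with its usual norm $\|\cdot\|_2$. For $\hat{\mathbf g}\in\mathscr H$ let $\hat{\mathbf g}^{(m)}\in\mathbb C^{M+1}$ denote its $m$-th component (the $m$-th Fourier mode). Let $\alpha_E>0$, let $\alpha$ be a real function with $\alpha(t)\ge\alpha_E t$ for all $t>0$, and let $w\in L^\infty([0,D]\times[0,\infty))$ (real- or complex-valued). The force is $E(x,t)=e^{-\alpha(t)}w(x,t)$. Let $\hat w^{(l)}(t)=\frac1D\int_0^D w(x,t)e^{-\imath lkx}\,dx$,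 and define operators on $\mathscr H$ by $$\bigl(e^{t\hat{\mathbf A}}\hat{\mathbf g}\bigr)^{(m)}=e^{t\mathbf A_m}\hat{\mathbf g}^{(m)},\qquad \bigl(\hat{\mathbf B}(t)\hat{\mathbf g}\bigr)^{(m)}=\sum_{l\in\mathbb Z}\hat w^{(l)}(t)\,\mathbf B\,\hat{\mathbf g}^{(m-l)},\qquad m\in\mathbb Z$$ ($\hat{\mathbf B}(t)$ is defined in this way for almost every $t\ge0$). Let $\hat{\mathbf f}:[0,\infty)\to\mathscr H$ be a mild solution of the filtered semi-discrete advection equation $\partial_t\mathbf f+\mathbf A\,\partial_x\mathbf f-E\mathbf B\mathbf f=\mathbf H\mathbf f$ with $D$-periodic boundary condition in $x$; that is, for every $t\ge 0$ the integrand below is Bochner integrable on $[0,t]$ and $$\hat{\mathbf f}(t)=e^{t\hat{\mathbf A}}\hat{\mathbf f}(0)+\int_0^t e^{-\alpha(s)}\,e^{(t-s)\hat{\mathbf A}}\,\hat{\mathbf B}(s)\hat{\mathbf f}(s)\,ds .$$ Then there exists $\hat{\mathbf f}_\infty\in\mathscr H$ such that $$\lim_{t\to+\infty}\|\hat{\mathbf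 f}(t)-\hat{\mathbf f}_\infty\|_2=0\qquad\text{and}\qquad \hat{\mathbf f}_\infty^{(m)}=0\quad\text{for all } m\in\mathbb Z\setminus\{0\}.$$ -/

import Mathlib

open MeasureTheory Filter Topology
open scoped ENNReal

noncomputable section

namespace FilteredVlasov

/-- The coefficient space `ℂ^(M+1)` with its Euclidean norm. -/
abbrev Coeff (M : ℕ) : Type := EuclideanSpace ℂ (Fin (M + 1))

/-- The Hilbert space `ℓ²(ℤ; ℂ^(M+1))` of sequences of Fourier modes. -/
abbrev ModeSpace (M : ℕ) : Type := lp (fun _ : ℤ => Coeff M) 2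

/-- The symmetric tridiagonal matrix with zero diagonal and off-diagonal entries
`√1, √2, …, √M`. -/
def matA (M : ℕ) : Matrix (Fin (M + 1)) (Fin (M + 1)) ℂ :=
  Matrix.of fun i j =>
    if (j : ℕ) = i + 1 then ((Real.sqrt (j : ℕ) : ℝ) : ℂ)
    else if (i : ℕ) = j + 1 then ((Real.sqrt (i : ℕ) : ℝ) : ℂ)
    else 0

/-- The matrix with subdiagonal entries `√1, √2, …, √M` and zeros elsewhere. -/
def matB (M : ℕ) : Matrix (Fin (M + 1)) (Fin (M + 1)) ℂ :=
  Matrix.of fun i j =>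
    if (i : ℕ) = j + 1 then ((Real.sqrt (i : ℕ) : ℝ) : ℂ) else 0

/-- The filter matrix `H = diag(h_0, …, h_M)`. -/
def matH {M : ℕ} (h : Fin (M + 1) → ℝ) : Matrix (Fin (M + 1)) (Fin (M + 1)) ℂ :=
  Matrix.diagonal fun i => (h i : ℂ)

/-- `A_m = -i m k A + H` with `k = 2π / D`. -/
def matAm {M : ℕ} (D : ℝ) (h : Fin (M + 1) → ℝ) (m : ℤ) :
    Matrix (Fin (M + 1)) (Fin (M + 1)) ℂ :=
  (-(Complex.I * (m : ℂ) * ((2 * Real.pi / D : ℝ) : ℂ))) • matA M + matH h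

/-- The matrix exponential `exp(t A_m)` as an operator on `ℂ^(M+1)`. -/
def expAm {M : ℕ} (D : ℝ) (h : Fin (M + 1) → ℝ) (m : ℤ) (t : ℝ) : Coeff M →L[ℂ] Coeff M :=
  NormedSpace.exp ((t : ℂ) • Matrix.toEuclideanCLM (n := Fin (M + 1)) (𝕜 := ℂ) (matAm D h m))

/-! Growth bound for `exp(t A_m)`, uniform in `m`: it shows that the block-diagonal family
`exp(t A_m)`, `m ∈ ℤ`, maps `ℓ²` to itself. -/

theorem norm_exp_smul_apply_le {F : Type*} [NormedAddCommGroup F] [InnerProductSpace ℂ F]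
    [CompleteSpace F] (L : F →L[ℂ] F) (c : ℝ)
    (hL : ∀ x, (inner ℂ x (L x)).re ≤ c * ‖x‖ ^ 2) (t : ℝ) (ht : 0 ≤ t) (v : F) :
    ‖NormedSpace.exp ((t : ℂ) • L) v‖ ≤ Real.exp (c * t) * ‖v‖ := by
  have hd : ∀ s : ℝ, HasDerivAt (fun s : ℝ => NormedSpace.exp ((s : ℂ) • L) v)
      (L (NormedSpace.exp ((s : ℂ) • L) v)) s := by
    intro s
    have h1 := hasDerivAt_exp_smul_const' L (s : ℂ)
    have h2 := ((ContinuousLinearMap.apply ℂ (F) v).hasFDerivAt).comp_hasDerivAt (s : ℂ) h1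
    have h3 := h2.scomp s Complex.ofRealCLM.hasDerivAt
    exact h3.congr_deriv (by simp)
  set y : ℝ → F := fun s : ℝ => NormedSpace.exp ((s : ℂ) • L) v with hy
  have hn : ∀ s : ℝ, HasDerivAt (fun s : ℝ => ‖y s‖ ^ 2)
      (2 * (inner ℂ (y s) (L (y s))).re) s := by
    intro s
    have h1 := Complex.reCLM.hasFDerivAt.comp_hasDerivAt s ((hd s).inner ℂ (hd s))
    have h2 : (fun s : ℝ => ‖y s‖ ^ 2) = Complex.reCLM ∘ fun s => inner ℂ (y s) (y s) := by
      funext r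
      exact (inner_self_eq_norm_sq (𝕜 := ℂ) (y r)).symm
    rw [h2]
    refine h1.congr_deriv ?_
    have h3 : (inner ℂ (L (y s)) (y s)).re = (inner ℂ (y s) (L (y s))).re :=
      inner_re_symm (𝕜 := ℂ) _ _
    change (inner ℂ (y s) (L (y s)) + inner ℂ (L (y s)) (y s)).re = _
    rw [Complex.add_re, h3]
    ring
  have hφ : ∀ s : ℝ, HasDerivAt (fun s : ℝ => ‖y s‖ ^ 2 * Real.exp (-(2 * c) * s))
      (2 * (inner ℂ (y s) (L (y s))).re * Real.exp (-(2 * c) * s)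
        + ‖y s‖ ^ 2 * (Real.exp (-(2 * c) * s) * (-(2 * c) * 1))) s := by
    intro s
    exact (hn s).mul (((hasDerivAt_id s).const_mul (-(2 * c))).exp)
  have hanti : Antitone (fun s : ℝ => ‖y s‖ ^ 2 * Real.exp (-(2 * c) * s)) := by
    apply antitone_of_deriv_nonpos (fun s => (hφ s).differentiableAt)
    intro s
    rw [(hφ s).deriv]
    have h1 := hL (y s)
    have h2 := Real.exp_pos (-(2 * c) * s)
    nlinarith [mul_le_mul_of_nonneg_right h1 h2.le]
  have h0 := hanti ht
  have hy0 : y 0 = v := by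
    simp only [hy, Complex.ofReal_zero]
    rw [zero_smul, NormedSpace.exp_zero, one_apply_eq_self]
  simp only [hy0, mul_zero, Real.exp_zero, mul_one] at h0
  apply abs_le_of_sq_le_sq' _ (by positivity) |>.2
  have he : Real.exp (-(2 * c) * t) * (Real.exp (c * t)) ^ 2 = 1 := by
    rw [sq, ← Real.exp_add, ← Real.exp_add]
    have : -(2 * c) * t + (c * t + c * t) = 0 := by ring
    rw [this, Real.exp_zero]
  calc ‖y t‖ ^ 2 = (‖y t‖ ^ 2 * Real.exp (-(2 * c) * t)) * (Real.exp (c * t)) ^ 2 := by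
        rw [mul_assoc, he, mul_one]
    _ ≤ ‖v‖ ^ 2 * (Real.exp (c * t)) ^ 2 := by gcongr
    _ = (Real.exp (c * t) * ‖v‖) ^ 2 := by ring

theorem matA_isHermitian (M : ℕ) : (matA M).IsHermitian := by
  ext i j
  simp only [matA, Matrix.conjTranspose_apply, Matrix.of_apply]
  split_ifs <;> first | omega | simp

theorem abs_re_inner_matAm_le {M : ℕ} (D : ℝ) (h : Fin (M + 1) → ℝ) (m : ℤ) (x : Coeff M) :
    |(inner ℂ x (Matrix.toEuclideanCLM (n := Fin (M + 1)) (𝕜 := ℂ) (matAm D h m) x)).re| ≤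
      ‖Matrix.toEuclideanCLM (n := Fin (M + 1)) (𝕜 := ℂ) (matH h)‖ * ‖x‖ ^ 2 := by
  have hA : IsSelfAdjoint (Matrix.toEuclideanCLM (n := Fin (M + 1)) (𝕜 := ℂ) (matA M)) := by
    rw [IsSelfAdjoint, ← map_star]
    congr 1
    exact matA_isHermitian M
  have him : (inner ℂ x (Matrix.toEuclideanCLM (n := Fin (M + 1)) (𝕜 := ℂ) (matA M) x)).im = 0 :=
    hA.isSymmetric.im_inner_self_apply x
  have hre : (inner ℂ x (Matrix.toEuclideanCLM (n := Fin (M + 1)) (𝕜 := ℂ) (matAm D h m) x)).re =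
      (inner ℂ x (Matrix.toEuclideanCLM (n := Fin (M + 1)) (𝕜 := ℂ) (matH h) x)).re := by
    rw [matAm, map_add, map_smul, _root_.add_apply, _root_.smul_apply,
      inner_add_right, inner_smul_right, Complex.add_re, Complex.mul_re, him]
    simp
  rw [hre]
  calc _ ≤ ‖inner ℂ x (Matrix.toEuclideanCLM (n := Fin (M + 1)) (𝕜 := ℂ) (matH h) x)‖ :=
        Complex.abs_re_le_norm _
    _ ≤ ‖x‖ * ‖Matrix.toEuclideanCLM (n := Fin (M + 1)) (𝕜 := ℂ) (matH h) x‖ :=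
        norm_inner_le_norm _ _
    _ ≤ ‖x‖ * (‖Matrix.toEuclideanCLM (n := Fin (M + 1)) (𝕜 := ℂ) (matH h)‖ * ‖x‖) := by
        gcongr
        exact ContinuousLinearMap.le_opNorm _ _
    _ = _ := by ring

theorem norm_expAm_apply_le {M : ℕ} (D : ℝ) (h : Fin (M + 1) → ℝ) (m : ℤ) (t : ℝ) (v : Coeff M) :
    ‖expAm D h m t v‖ ≤
      Real.exp (‖Matrix.toEuclideanCLM (n := Fin (M + 1)) (𝕜 := ℂ) (matH h)‖ * |t|) * ‖v‖ := by
  rcases le_total 0 t with ht | ht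
  · rw [abs_of_nonneg ht]
    exact norm_exp_smul_apply_le _ _
      (fun x => (abs_le.1 (abs_re_inner_matAm_le D h m x)).2) t ht v
  · rw [abs_of_nonpos ht]
    have key := norm_exp_smul_apply_le
      (-Matrix.toEuclideanCLM (n := Fin (M + 1)) (𝕜 := ℂ) (matAm D h m))
      ‖Matrix.toEuclideanCLM (n := Fin (M + 1)) (𝕜 := ℂ) (matH h)‖
      (fun x => by
        have := (abs_le.1 (abs_re_inner_matAm_le D h m x)).1
        rw [_root_.neg_apply, inner_neg_right, Complex.neg_re]
        linarith) (-t) (by linarith) v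
    rw [Complex.ofReal_neg, smul_neg, neg_smul, neg_neg] at key
    exact key

theorem memℓp_expAm {M : ℕ} (D : ℝ) (h : Fin (M + 1) → ℝ) (t : ℝ) (g : ModeSpace M) :
    Memℓp (fun m : ℤ => expAm D h m t (g m)) 2 := by
  have hg := lp.memℓp (((Real.exp (‖Matrix.toEuclideanCLM (n := Fin (M + 1)) (𝕜 := ℂ)
    (matH h)‖ * |t|) : ℝ) : ℂ) • g)
  have h2 : 0 < (2 : ℝ≥0∞).toReal := by norm_num
  rw [memℓp_gen_iff h2] at hg ⊢
  refine Summable.of_nonneg_of_le (fun m => by positivity) (fun m => ?_) hg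
  refine Real.rpow_le_rpow (norm_nonneg _) ?_ h2.le
  rw [lp.coeFn_smul, Pi.smul_apply, norm_smul, Complex.norm_real, Real.norm_eq_abs, Real.abs_exp]
  exact norm_expAm_apply_le D h m t (g m)

/-- The operator `exp(t Â)` on `ℓ²(ℤ; ℂ^(M+1))`, where `Â` is the block-diagonal operator
`(Â g)^(m) = A_m g^(m)`: its blocks are the matrix exponentials `exp(t A_m)`. -/
def expAhat {M : ℕ} (D : ℝ) (h : Fin (M + 1) → ℝ) (t : ℝ) (g : ModeSpace M) : ModeSpace M :=
  ⟨fun m : ℤ => expAm D h m t (g m), memℓp_expAm D h t g⟩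

/-- The spatial Fourier coefficient `ŵ^(l)(t) = (1/D) ∫_0^D w(x,t) exp(-i l k x) dx`. -/
def wHat {D : ℝ} (hD : 0 < D) (w : ℝ → ℝ → ℂ) (l : ℤ) (t : ℝ) : ℂ :=
  fourierCoeffOn hD (fun x => w x t) l

/-- The `m`-th mode `∑_l ŵ^(l)(t) B g^(m-l)` of `B̂(t) g`. -/
def forceMode {M : ℕ} {D : ℝ} (hD : 0 < D) (w : ℝ → ℝ → ℂ) (t : ℝ) (g : ModeSpace M) (m : ℤ) :
    Coeff M :=
  ∑' l : ℤ, wHat hD w l t •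
    Matrix.toEuclideanCLM (n := Fin (M + 1)) (𝕜 := ℂ) (matB M) (g (m - l))

open Classical in
/-- The operator `B̂(t)` on `ℓ²(ℤ; ℂ^(M+1))`. For every `t` with `w(·,t) ∈ L^∞(0,D)`, hence for
almost every `t ≥ 0` when `w ∈ L^∞`, the modes form an `ℓ²` sequence for all `g`; the value `0`
is only a convention for the remaining null set of times. -/
def Bhat {M : ℕ} {D : ℝ} (hD : 0 < D) (w : ℝ → ℝ → ℂ) (t : ℝ) (g : ModeSpace M) : ModeSpace M :=
  if hg : Memℓp (fun m : ℤ => forceMode hD w t g m) 2 then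
    ⟨fun m : ℤ => forceMode hD w t g m, hg⟩
  else 0

/-- The integrand `exp(-α(s)) exp((t-s) Â) B̂(s) f(s)` of Duhamel's formula. -/
def duhamelIntegrand {M : ℕ} {D : ℝ} (hD : 0 < D) (h : Fin (M + 1) → ℝ) (α : ℝ → ℝ)
    (w : ℝ → ℝ → ℂ) (f : ℝ → ModeSpace M) (t s : ℝ) : ModeSpace M :=
  ((Real.exp (-α s) : ℝ) : ℂ) • expAhat D h (t - s) (Bhat hD w s (f s))

/-- `f : [0,∞) → ℓ²(ℤ; ℂ^(M+1))` solves the Duhamel integral equation: for every `t ≥ 0` the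
integrand is Bochner integrable on `[0,t]` and
`f(t) = exp(t Â) f(0) + ∫_0^t exp(-α(s)) exp((t-s) Â) B̂(s) f(s) ds`.
Values of `f` at negative times play no role. -/
def IsMildSolution {M : ℕ} {D : ℝ} (hD : 0 < D) (h : Fin (M + 1) → ℝ) (α : ℝ → ℝ)
    (w : ℝ → ℝ → ℂ) (f : ℝ → ModeSpace M) : Prop :=
  ∀ t : ℝ, 0 ≤ t →
    IntervalIntegrable (duhamelIntegrand hD h α w f t) volume 0 t ∧
    f t = expAhat D h t (f 0) + ∫ s in (0 : ℝ)..t, duhamelIntegrand hD h α w f t s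

end FilteredVlasov

end

/-! Write F(s) = e^{-α(s)} B̂(s) f(s) for the forcing, so that Duhamel's formula reads f(t) = e^{tÂ}
f(0) + ∫_0^t e^{(t-s)Â} F(s) ds. Two facts suffice: e^{tÂ} is a contraction for t ≥ 0 and converges
strongly to a limit P whose values have only the zeroth mode (`exists_tendsto_expAhat`); and ‖F(s)‖
≤ K e^{-α_E s} for almost every s > 0 (`IsMildSolution.exists_norm_forcing_le`). Dominated
convergence then gives f(t) → P f(0) + ∫_0^∞ P F(s) ds.

Strong convergence: along y = exp(t A_m) v one has d/dt ‖y‖² = 2 ∑ h_i |y_i|² ≤ 0. Damping may act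
on the last coordinate alone, but for m ≠ 0 a trajectory of constant norm has vanishing last
coordinate, and the tridiagonal coupling then kills all the others. Hence ‖exp(A_m)‖ < 1
(`norm_expAm_one_lt_one`) and the block decays. No rate uniform in m is needed, since contractivity
allows dominated convergence over the modes. For m = 0 the block is diagonal with entries e^{h_i t}.

Decay of F: on the Fourier side B̂(t) is multiplication by w(·,t) composed with B, hence bounded
uniformly in almost every t (`exists_norm_Bhat_le`). Gronwall with the integrable coefficient C
e^{-α_E s} bounds f uniformly in time. -/

namespace FilteredVlasov

/-! ### Dissipation and long-time limits of the blocks exp(t A_m) -/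

variable {M : ℕ} (D : ℝ) (h : Fin (M + 1) → ℝ) (m : ℤ)

theorem hasDerivAt_exp_smul_apply {F : Type*} [NormedAddCommGroup F] [NormedSpace ℂ F]
    [CompleteSpace F] (L : F →L[ℂ] F) (v : F) (s : ℝ) :
    HasDerivAt (fun s : ℝ => NormedSpace.exp ((s : ℂ) • L) v)
      (L (NormedSpace.exp ((s : ℂ) • L) v)) s := by
  have h1 := hasDerivAt_exp_smul_const' L (s : ℂ)
  have h2 := ((ContinuousLinearMap.apply ℂ F v).hasFDerivAt).comp_hasDerivAt (s : ℂ) h1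
  have h3 := h2.scomp s Complex.ofRealCLM.hasDerivAt
  exact h3.congr_deriv (by simp)

theorem exp_ofReal_add_smul {R : Type*} [NormedRing R] [NormedAlgebra ℂ R] [CompleteSpace R]
    (L : R) (s t : ℝ) : NormedSpace.exp (((s + t : ℝ) : ℂ) • L) =
      NormedSpace.exp ((s : ℂ) • L) * NormedSpace.exp ((t : ℂ) • L) := by
  let _ := NormedAlgebra.restrictScalars ℚ ℂ R
  rw [Complex.ofReal_add, add_smul]
  exact NormedSpace.exp_add_of_commute (((Commute.refl _).smul_left _).smul_right _)

theorem exp_ofReal_zero_smul {R : Type*} [NormedRing R] [NormedAlgebra ℂ R] (L : R) :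
    NormedSpace.exp (((0 : ℝ) : ℂ) • L) = 1 := by
  rw [Complex.ofReal_zero, zero_smul, NormedSpace.exp_zero]

theorem continuous_exp_ofReal_smul {R : Type*} [NormedRing R] [NormedAlgebra ℂ R]
    [CompleteSpace R] (L : R) : Continuous fun t : ℝ => NormedSpace.exp ((t : ℂ) • L) := by
  let _ := NormedAlgebra.restrictScalars ℚ ℂ R
  have : Continuous fun A : R => NormedSpace.exp A := NormedSpace.exp_continuous
  fun_prop

theorem hasDerivAt_expAm (v : Coeff M) (s : ℝ) :
    HasDerivAt (fun s : ℝ => expAm D h m s v)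
      (Matrix.toEuclideanCLM (n := Fin (M + 1)) (𝕜 := ℂ) (matAm D h m) (expAm D h m s v)) s :=
  hasDerivAt_exp_smul_apply (F := Coeff M) _ v s

theorem expAm_add (s t : ℝ) : expAm D h m (s + t) = expAm D h m s * expAm D h m t :=
  exp_ofReal_add_smul (R := Coeff M →L[ℂ] Coeff M) _ s t

theorem expAm_zero : expAm D h m 0 = 1 :=
  exp_ofReal_zero_smul (R := Coeff M →L[ℂ] Coeff M) _

theorem expAm_neg_apply_apply (t : ℝ) (v : Coeff M) :
    expAm D h m (-t) (expAm D h m t v) = v := by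
  have := expAm_add D h m (-t) t
  rw [neg_add_cancel, expAm_zero] at this
  exact (DFunLike.congr_fun this v).symm

theorem continuous_expAm : Continuous (expAm D h m) :=
  continuous_exp_ofReal_smul (R := Coeff M →L[ℂ] Coeff M) _

theorem toEuclideanCLM_matAm_apply (x : Coeff M) (i : Fin (M + 1)) :
    Matrix.toEuclideanCLM (n := Fin (M + 1)) (𝕜 := ℂ) (matAm D h m) x i =
      -(Complex.I * (m : ℂ) * ((2 * Real.pi / D : ℝ) : ℂ)) * (∑ j, matA M i j * x j)
        + h i * x i := by
  rw [Matrix.ofLp_toEuclideanCLM, matAm, Matrix.add_mulVec, Matrix.smul_mulVec, matH,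
    Pi.add_apply, Pi.smul_apply, Matrix.mulVec_diagonal]
  simp [Matrix.mulVec, dotProduct]

/-- Since A is Hermitian and -imk is purely imaginary, transport contributes nothing to the energy;
only the filter dissipates. -/
theorem re_inner_matAm (x : Coeff M) :
    (inner ℂ x (Matrix.toEuclideanCLM (n := Fin (M + 1)) (𝕜 := ℂ) (matAm D h m) x)).re =
      ∑ i, h i * ‖x i‖ ^ 2 := by
  have hA : IsSelfAdjoint (Matrix.toEuclideanCLM (n := Fin (M + 1)) (𝕜 := ℂ) (matA M)) := by
    rw [IsSelfAdjoint, ← map_star]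
    congr 1
    exact matA_isHermitian M
  have him : (inner ℂ x (Matrix.toEuclideanCLM (n := Fin (M + 1)) (𝕜 := ℂ) (matA M) x)).im = 0 :=
    hA.isSymmetric.im_inner_self_apply x
  have hre : (inner ℂ x (Matrix.toEuclideanCLM (n := Fin (M + 1)) (𝕜 := ℂ) (matAm D h m) x)).re =
      (inner ℂ x (Matrix.toEuclideanCLM (n := Fin (M + 1)) (𝕜 := ℂ) (matH h) x)).re := by
    rw [matAm, map_add, map_smul, _root_.add_apply, _root_.smul_apply,
      inner_add_right, inner_smul_right, Complex.add_re, Complex.mul_re, him]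
    simp
  rw [hre, PiLp.inner_apply, Complex.re_sum]
  refine Finset.sum_congr rfl fun i _ => ?_
  rw [Matrix.ofLp_toEuclideanCLM, matH, Matrix.mulVec_diagonal, ← smul_eq_mul, inner_smul_right,
    inner_self_eq_norm_sq_to_K]
  norm_cast
  rw [Complex.re_ofReal_mul]
  exact congrArg _ (Complex.ofReal_re _)

theorem norm_expAm_apply_le_of_nonneg (h_nonpos : ∀ i, h i ≤ 0) {t : ℝ} (ht : 0 ≤ t)
    (v : Coeff M) : ‖expAm D h m t v‖ ≤ ‖v‖ := by
  have := norm_exp_smul_apply_le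
    (Matrix.toEuclideanCLM (n := Fin (M + 1)) (𝕜 := ℂ) (matAm D h m)) 0 (fun x => by
      rw [re_inner_matAm, zero_mul]
      exact Finset.sum_nonpos fun i _ => mul_nonpos_of_nonpos_of_nonneg (h_nonpos i) (by positivity))
    t ht v
  rwa [zero_mul, Real.exp_zero, one_mul] at this

theorem hasDerivAt_norm_sq_expAm (v : Coeff M) (s : ℝ) :
    HasDerivAt (fun s : ℝ => ‖expAm D h m s v‖ ^ 2)
      (2 * ∑ i, h i * ‖expAm D h m s v i‖ ^ 2) s := by
  have hd := hasDerivAt_expAm D h m v s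
  have h1 := Complex.reCLM.hasFDerivAt.comp_hasDerivAt s (hd.inner ℂ hd)
  have h2 : (fun s : ℝ => ‖expAm D h m s v‖ ^ 2) =
      Complex.reCLM ∘ fun s => inner ℂ (expAm D h m s v) (expAm D h m s v) := by
    funext r
    exact (inner_self_eq_norm_sq (𝕜 := ℂ) _).symm
  rw [h2]
  refine h1.congr_deriv ?_
  rw [← re_inner_matAm, map_add]
  have h3 := inner_re_symm (𝕜 := ℂ)
    (Matrix.toEuclideanCLM (n := Fin (M + 1)) (𝕜 := ℂ) (matAm D h m) (expAm D h m s v))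
    (expAm D h m s v)
  change _ + (inner ℂ (Matrix.toEuclideanCLM (n := Fin (M + 1)) (𝕜 := ℂ) (matAm D h m)
    (expAm D h m s v)) (expAm D h m s v)).re = _
  rw [show (inner ℂ (Matrix.toEuclideanCLM (n := Fin (M + 1)) (𝕜 := ℂ) (matAm D h m)
    (expAm D h m s v)) (expAm D h m s v)).re = _ from h3]
  exact (two_mul _).symm

theorem hasDerivAt_expAm_coord (v : Coeff M) (i : Fin (M + 1)) (s : ℝ) :
    HasDerivAt (fun s : ℝ => expAm D h m s v i)
      (-(Complex.I * (m : ℂ) * ((2 * Real.pi / D : ℝ) : ℂ)) *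
        (∑ j, matA M i j * expAm D h m s v j) + h i * expAm D h m s v i) s := by
  rw [← toEuclideanCLM_matAm_apply]
  exact ((EuclideanSpace.proj (𝕜 := ℂ) i : Coeff M →L[ℂ] ℂ).restrictScalars ℝ).hasFDerivAt.comp_hasDerivAt s
    (hasDerivAt_expAm D h m v s)

variable {D h m}

/-- If the last coordinate of `exp(t A_m) v` vanishes on `(0,1)`, then so do all coordinates:
the coupling through `A` propagates the zeros downwards. -/
theorem expAm_coord_eq_zero (hD : 0 < D) (hm : m ≠ 0) (v : Coeff M)
    (hlast : ∀ s ∈ Set.Ioo (0 : ℝ) 1, expAm D h m s v (Fin.last M) = 0) (n : ℕ) :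
    ∀ i : Fin (M + 1), M ≤ n + i → ∀ s ∈ Set.Ioo (0 : ℝ) 1, expAm D h m s v i = 0 := by
  induction n with
  | zero =>
    intro i hi
    have : i = Fin.last M := Fin.ext (by have := i.2; simp only [Fin.val_last]; omega)
    exact this ▸ hlast
  | succ n ih =>
    intro i hi s hs
    by_cases hin : M ≤ n + i
    · exact ih i hin s hs
    -- Here i = M - n - 1. Row i + 1 of the equation couples x_i, x_{i+1} and x_{i+2}; the last two
    -- vanish on the interval, and so does the derivative of x_{i+1}. What remains is -imk √(i+1)
    -- x_i = 0.
    set k : Fin (M + 1) := ⟨i + 1, by omega⟩ with hk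
    have hkv : (k : ℕ) = i + 1 := rfl
    have hz : ∀ r ∈ Set.Ioo (0 : ℝ) 1, expAm D h m r v k = 0 := ih k (by omega)
    have hd := hasDerivAt_expAm_coord D h m v k s
    have hd0 : HasDerivAt (fun s : ℝ => expAm D h m s v k) 0 s :=
      (hasDerivAt_const s (0 : ℂ)).congr_of_eventuallyEq
        (Filter.eventually_of_mem (isOpen_Ioo.mem_nhds hs) hz)
    have heq := hd.unique hd0
    rw [hz s hs, mul_zero, add_zero, Finset.sum_eq_single i] at heq
    · have hc : matA M k i ≠ 0 := by
        rw [matA, Matrix.of_apply, if_neg (by omega), if_pos hkv]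
        rw [Complex.ofReal_ne_zero]
        exact (Real.sqrt_pos.2 (by rw [hkv]; positivity)).ne'
      have hpi : ((2 * Real.pi / D : ℝ) : ℂ) ≠ 0 :=
        Complex.ofReal_ne_zero.2 (by positivity)
      have hm' : (m : ℂ) ≠ 0 := by exact_mod_cast hm
      simpa [hc, hpi, hm', Complex.I_ne_zero, -Complex.ofReal_div, -Complex.ofReal_mul] using heq
    · intro j _ hj
      by_cases hjk : (j : ℕ) = k + 1
      · rw [ih j (by omega) s hs, mul_zero]
      · have : matA M k j = 0 := by
          rw [matA, Matrix.of_apply, if_neg hjk, if_neg fun hh => hj (Fin.ext (by omega))]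
        rw [this, zero_mul]
    · simp

/-- Otherwise the nonincreasing norm is constant on [0,1], so the sum of the nonpositive terms h_i
|y_i|² vanishes there and the last coordinate is zero. Propagation makes y(1/2) = 0, against
‖y(1/2)‖ = ‖v‖. -/
theorem norm_expAm_one_apply_lt (hD : 0 < D) (h_nonpos : ∀ i, h i ≤ 0)
    (h_last : h (Fin.last M) < 0) (hm : m ≠ 0) {v : Coeff M} (hv : v ≠ 0) :
    ‖expAm D h m 1 v‖ < ‖v‖ := by
  by_contra hcon
  have hanti : ∀ s t : ℝ, s ≤ t → ‖expAm D h m t v‖ ≤ ‖expAm D h m s v‖ := by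
    intro s t hst
    have := expAm_add D h m (t - s) s
    rw [sub_add_cancel] at this
    rw [this]
    exact norm_expAm_apply_le_of_nonneg D h m h_nonpos (sub_nonneg.2 hst) _
  have h0 : expAm D h m 0 v = v := by rw [expAm_zero]; rfl
  have hconst : ∀ s ∈ Set.Ioo (0 : ℝ) 1, ‖expAm D h m s v‖ = ‖v‖ := by
    intro s hs
    have h1 := hanti 0 s hs.1.le
    have h2 := hanti s 1 hs.2.le
    rw [h0] at h1
    linarith
  have hlast : ∀ s ∈ Set.Ioo (0 : ℝ) 1, expAm D h m s v (Fin.last M) = 0 := by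
    intro s hs
    have hd0 : HasDerivAt (fun s : ℝ => ‖expAm D h m s v‖ ^ 2) 0 s :=
      (hasDerivAt_const s (‖v‖ ^ 2)).congr_of_eventuallyEq
        (Filter.eventually_of_mem (isOpen_Ioo.mem_nhds hs) fun r hr => by
          simp only [hconst r hr])
    have heq := (hasDerivAt_norm_sq_expAm D h m v s).unique hd0
    have hsum : ∑ i, h i * ‖expAm D h m s v i‖ ^ 2 = 0 := by linarith
    have hi := (Finset.sum_eq_zero_iff_of_nonpos fun i _ =>
      mul_nonpos_of_nonpos_of_nonneg (h_nonpos i) (sq_nonneg _)).1 hsum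
        (Fin.last M) (Finset.mem_univ _)
    simpa [h_last.ne] using hi
  have hz : expAm D h m (1 / 2) v = 0 := by
    ext i
    exact expAm_coord_eq_zero hD hm v hlast M i (by omega) (1 / 2) (by norm_num)
  have := hconst (1 / 2) (by norm_num)
  rw [hz, norm_zero] at this
  exact hv (norm_eq_zero.1 this.symm)

/-- Compactness of the unit sphere in finite dimension turns the pointwise strict inequality into
one for the operator norm. -/
theorem norm_expAm_one_lt_one (hD : 0 < D) (h_nonpos : ∀ i, h i ≤ 0)
    (h_last : h (Fin.last M) < 0) (hm : m ≠ 0) : ‖expAm D h m 1‖ < 1 := by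
  obtain ⟨v, hv, hmax⟩ := (isCompact_sphere (0 : Coeff M) 1).exists_isMaxOn
    (NormedSpace.sphere_nonempty.2 zero_le_one) (f := fun v => ‖expAm D h m 1 v‖) (by fun_prop)
  have hv1 : ‖v‖ = 1 := by simpa using hv
  have hlt := norm_expAm_one_apply_lt hD h_nonpos h_last hm
    (norm_ne_zero_iff.1 (by rw [hv1]; exact one_ne_zero) : v ≠ 0)
  rw [hv1] at hlt
  refine lt_of_le_of_lt ?_ hlt
  refine ContinuousLinearMap.opNorm_le_of_unit_norm (𝕜 := ℂ) (norm_nonneg _) fun z hz => ?_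
  exact hmax (by simpa using hz)

/-- Powers of exp(A_m) decay geometrically at integer times, and contractivity covers the fractional
part of t. -/
theorem tendsto_expAm_of_ne_zero (hD : 0 < D) (h_nonpos : ∀ i, h i ≤ 0)
    (h_last : h (Fin.last M) < 0) (hm : m ≠ 0) (v : Coeff M) :
    Tendsto (fun t : ℝ => expAm D h m t v) atTop (𝓝 0) := by
  have hlt := norm_expAm_one_lt_one hD h_nonpos h_last hm
  have hpow : ∀ n : ℕ, expAm D h m n = expAm D h m 1 ^ n := by
    intro n
    induction n with
    | zero => rw [Nat.cast_zero, expAm_zero, pow_zero]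
    | succ n ih => rw [Nat.cast_succ, expAm_add, ih, pow_succ]
  have hlim : Tendsto (fun t : ℝ => ‖expAm D h m 1‖ ^ ⌊t⌋₊ * ‖v‖) atTop (𝓝 0) := by
    simpa using ((tendsto_pow_atTop_nhds_zero_of_lt_one (norm_nonneg _) hlt).comp
      (tendsto_nat_floor_atTop (α := ℝ))).mul_const ‖v‖
  refine squeeze_zero_norm' ?_ hlim
  filter_upwards [eventually_ge_atTop 0] with t ht
  have hadd := expAm_add D h m (t - ⌊t⌋₊) ⌊t⌋₊
  rw [sub_add_cancel] at hadd
  rw [hadd]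
  refine (norm_expAm_apply_le_of_nonneg D h m h_nonpos
    (sub_nonneg.2 (Nat.floor_le ht)) _).trans ?_
  refine (ContinuousLinearMap.le_opNorm _ _).trans ?_
  rw [hpow]
  gcongr
  exact norm_pow_le _ _

theorem expAm_mode_zero_apply (t : ℝ) (v : Coeff M) (i : Fin (M + 1)) :
    expAm D h 0 t v i = Complex.exp (h i * t) * v i := by
  have hd : ∀ s : ℝ, HasDerivAt
      (fun s : ℝ => Complex.exp (-(h i * s)) * expAm D h 0 s v i) 0 s := by
    intro s
    have h1 := hasDerivAt_expAm_coord D h 0 v i s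
    have h2 : HasDerivAt (fun s : ℝ => Complex.exp (-(h i * s)))
        (Complex.exp (-(h i * s)) * (-(h i * 1))) s :=
      (((hasDerivAt_id s).ofReal_comp.const_mul (h i : ℂ)).neg).cexp
    refine (h2.mul h1).congr_deriv ?_
    simp only [Int.cast_zero, mul_zero, zero_mul, neg_zero]
    ring
  have hc := is_const_of_deriv_eq_zero (fun s => (hd s).differentiableAt)
    (fun s => (hd s).deriv) t 0
  simp only [expAm_zero, Complex.ofReal_zero, mul_zero, neg_zero, Complex.exp_zero, one_mul,
    one_apply_eq_self] at hc
  rw [← hc, ← mul_assoc, ← Complex.exp_add, add_neg_cancel, Complex.exp_zero, one_mul]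

theorem exists_tendsto_expAm_mode_zero (h_nonpos : ∀ i, h i ≤ 0) (v : Coeff M) :
    ∃ p : Coeff M, Tendsto (fun t : ℝ => expAm D h 0 t v) atTop (𝓝 p) := by
  have hc : ∀ i, ∃ c : ℂ, Tendsto (fun t : ℝ => expAm D h 0 t v i) atTop (𝓝 c) := by
    intro i
    simp only [expAm_mode_zero_apply]
    rcases (h_nonpos i).eq_or_lt with hi | hi
    · exact ⟨v i, by simp [hi]⟩
    · refine ⟨0 * v i, Tendsto.mul_const _ ?_⟩
      rw [tendsto_zero_iff_norm_tendsto_zero]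
      have : Tendsto (fun t : ℝ => Real.exp (h i * t)) atTop (𝓝 0) :=
        Real.tendsto_exp_atBot.comp (tendsto_id.const_mul_atTop_of_neg hi)
      refine this.congr fun t => ?_
      rw [← Complex.ofReal_mul, Complex.norm_exp_ofReal]
  choose c hc using hc
  refine ⟨WithLp.toLp 2 c, ?_⟩
  have := ((PiLp.continuous_toLp 2 (fun _ : Fin (M + 1) => ℂ)).tendsto c).comp
    (tendsto_pi_nhds.2 hc)
  exact this

/-- Each block `exp(t A_m)` converges strongly as `t → ∞`, to `0` when `m ≠ 0`. -/
theorem exists_tendsto_expAm (hD : 0 < D) (h_nonpos : ∀ i, h i ≤ 0)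
    (h_last : h (Fin.last M) < 0) (m : ℤ) (v : Coeff M) :
    ∃ p : Coeff M, Tendsto (fun t : ℝ => expAm D h m t v) atTop (𝓝 p) ∧ (m ≠ 0 → p = 0) := by
  by_cases hm : m = 0
  · subst hm
    obtain ⟨p, hp⟩ := exists_tendsto_expAm_mode_zero (D := D) h_nonpos v
    exact ⟨p, hp, fun hh => absurd rfl hh⟩
  · exact ⟨0, tendsto_expAm_of_ne_zero hD h_nonpos h_last hm v, fun _ => rfl⟩

end FilteredVlasov

/-! ### The semigroup on ℓ²: measurability and strong convergence -/

namespace FilteredVlasov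

theorem hasSum_norm_sq {ι : Type*} {E : ι → Type*} [∀ i, NormedAddCommGroup (E i)]
    (g : lp E 2) : HasSum (fun i => ‖g i‖ ^ 2) (‖g‖ ^ 2) := by
  have h2 : 0 < (2 : ℝ≥0∞).toReal := by norm_num
  simpa using lp.hasSum_norm h2 g

theorem memℓp_two_of_norm_le {ι : Type*} {E F : ι → Type*} [∀ i, NormedAddCommGroup (E i)]
    [∀ i, NormedAddCommGroup (F i)] {u : ∀ i, E i} (g : lp F 2) (hu : ∀ i, ‖u i‖ ≤ ‖g i‖) :
    Memℓp u 2 := by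
  have h2 : 0 < (2 : ℝ≥0∞).toReal := by norm_num
  refine memℓp_gen ?_
  simp only [ENNReal.toReal_ofNat, Real.rpow_two]
  refine (hasSum_norm_sq g).summable.of_nonneg_of_le (fun i => by positivity) fun i => ?_
  gcongr
  exact hu i

theorem tendsto_lp_two_of_dominated {ι X : Type*} {E F : ι → Type*}
    [∀ i, NormedAddCommGroup (E i)] [∀ i, NormedAddCommGroup (F i)] {l : Filter X}
    {u : X → lp E 2} {p : lp E 2} (g : lp F 2) (hu : ∀ᶠ x in l, ∀ i, ‖u x i - p i‖ ≤ ‖g i‖)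
    (hlim : ∀ i, Tendsto (fun x => u x i) l (𝓝 (p i))) : Tendsto u l (𝓝 p) := by
  rw [tendsto_iff_norm_sub_tendsto_zero]
  have hsq : Tendsto (fun x => ‖u x - p‖ ^ 2) l (𝓝 0) := by
    have := tendsto_tsum_of_dominated_convergence (𝓕 := l) (f := fun x i => ‖u x i - p i‖ ^ 2)
      (g := fun _ => (0 : ℝ)) (hasSum_norm_sq g).summable
      (fun i => by
        have := ((tendsto_iff_norm_sub_tendsto_zero.1 (hlim i)).pow 2)
        simpa using this)
      (hu.mono fun x hx i => by
        rw [Real.norm_of_nonneg (by positivity)]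
        gcongr
        exact hx i)
    rw [tsum_zero] at this
    refine this.congr fun x => ?_
    rw [← (hasSum_norm_sq (u x - p)).tsum_eq]
    rfl
  have := hsq.sqrt
  simpa using this

variable {M : ℕ} (D : ℝ) (h : Fin (M + 1) → ℝ)

theorem expAhat_apply (t : ℝ) (g : ModeSpace M) (m : ℤ) :
    expAhat D h t g m = expAm D h m t (g m) := rfl

theorem expAhat_smul (t : ℝ) (c : ℂ) (g : ModeSpace M) :
    expAhat D h t (c • g) = c • expAhat D h t g := by
  ext1
  funext m
  simp [expAhat_apply]

theorem expAhat_neg_expAhat (t : ℝ) (g : ModeSpace M) :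
    expAhat D h (-t) (expAhat D h t g) = g := by
  ext1
  funext m
  exact expAm_neg_apply_apply D h m t (g m)

theorem norm_expAhat_le_of_nonneg (h_nonpos : ∀ i, h i ≤ 0) {t : ℝ} (ht : 0 ≤ t)
    (g : ModeSpace M) : ‖expAhat D h t g‖ ≤ ‖g‖ :=
  lp.norm_mono (by norm_num) fun m => norm_expAm_apply_le_of_nonneg D h m h_nonpos ht (g m)

theorem norm_expAhat_le (t : ℝ) (g : ModeSpace M) :
    ‖expAhat D h t g‖ ≤
      Real.exp (‖Matrix.toEuclideanCLM (n := Fin (M + 1)) (𝕜 := ℂ) (matH h)‖ * |t|) * ‖g‖ := by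
  set c := Real.exp (‖Matrix.toEuclideanCLM (n := Fin (M + 1)) (𝕜 := ℂ) (matH h)‖ * |t|)
  have : ‖expAhat D h t g‖ ≤ ‖(c : ℂ) • g‖ := by
    refine lp.norm_mono (by norm_num) fun m => ?_
    rw [lp.coeFn_smul, Pi.smul_apply, norm_smul, Complex.norm_real, Real.norm_eq_abs, Real.abs_exp]
    exact norm_expAm_apply_le D h m t (g m)
  rwa [norm_smul, Complex.norm_real, Real.norm_eq_abs, Real.abs_exp] at this

/-- Each mode is measurable by continuity of t ↦ exp(t A_m), and the full sequence is the pointwise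
limit of its truncations to finitely many modes. -/
theorem aestronglyMeasurable_expAhat {μ : Measure ℝ} {F : ℝ → ModeSpace M} {τ : ℝ → ℝ}
    (hF : AEStronglyMeasurable F μ) (hτ : Continuous τ) :
    AEStronglyMeasurable (fun s => expAhat D h (τ s) (F s)) μ := by
  refine aestronglyMeasurable_of_tendsto_ae (atTop : Filter (Finset ℤ))
    (f := fun (S : Finset ℤ) s => ∑ m ∈ S, lp.single 2 m (expAm D h m (τ s) (F s m)))
    (fun S => ?_) (Eventually.of_forall fun s => ?_)
  · refine Finset.aestronglyMeasurable_fun_sum S fun m _ => ?_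
    refine (lp.isometry_single (E := fun _ : ℤ => Coeff M) m).continuous.comp_aestronglyMeasurable ?_
    have h1 : AEStronglyMeasurable (fun s => F s m) μ :=
      (lp.evalCLM ℂ (fun _ : ℤ => Coeff M) 2 m).continuous.comp_aestronglyMeasurable hF
    have h2 : AEStronglyMeasurable (fun s => expAm D h m (τ s)) μ :=
      ((continuous_expAm D h m).comp hτ).aestronglyMeasurable
    exact isBoundedBilinearMap_apply.continuous.comp_aestronglyMeasurable (h2.prodMk h1)
  · exact lp.hasSum_single (by norm_num) (expAhat D h (τ s) (F s))

variable {D h}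

/-- The semigroup `exp(t Â)` converges strongly as `t → ∞`, and the limits have only the zeroth
mode. -/
theorem exists_tendsto_expAhat (hD : 0 < D) (h_nonpos : ∀ i, h i ≤ 0)
    (h_last : h (Fin.last M) < 0) (g : ModeSpace M) :
    ∃ p : ModeSpace M, Tendsto (fun t : ℝ => expAhat D h t g) atTop (𝓝 p) ∧
      ∀ m : ℤ, m ≠ 0 → p m = 0 := by
  choose p hp hp0 using fun m => exists_tendsto_expAm hD h_nonpos h_last m (g m)
  have hle : ∀ m, ‖p m‖ ≤ ‖g m‖ := fun m => le_of_tendsto (hp m).norm <| by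
    filter_upwards [eventually_ge_atTop 0] with t ht
    exact norm_expAm_apply_le_of_nonneg D h m h_nonpos ht (g m)
  refine ⟨⟨p, memℓp_two_of_norm_le g hle⟩, ?_, hp0⟩
  refine tendsto_lp_two_of_dominated ((2 : ℂ) • g) ?_ hp
  filter_upwards [eventually_ge_atTop 0] with t ht m
  have h1 := norm_expAm_apply_le_of_nonneg D h m h_nonpos ht (g m)
  have h2 : ‖((2 : ℂ) • g) m‖ = 2 * ‖g m‖ := by
    rw [lp.coeFn_smul, Pi.smul_apply, norm_smul]; simp
  rw [h2]
  calc _ ≤ ‖expAm D h m t (g m)‖ + ‖p m‖ := norm_sub_le _ _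
    _ ≤ 2 * ‖g m‖ := by linarith [hle m]

end FilteredVlasov

/-! ### Boundedness of B̂(t) -/

open scoped ComplexConjugate

namespace FilteredVlasov

/-- Multiplication by a bounded function on the circle, on the Fourier side: convolution with its
Fourier coefficients is bounded on `ℓ²(ℤ)`, with the essential bound as norm. -/
theorem exists_lp_hasSum_fourierCoeff_mul {T : ℝ} [hT : Fact (0 < T)] {v : AddCircle T → ℂ}
    (hv : AEStronglyMeasurable v AddCircle.haarAddCircle) {W : ℝ}
    (hvW : ∀ᵐ x ∂AddCircle.haarAddCircle, ‖v x‖ ≤ W) (c : lp (fun _ : ℤ => ℂ) 2) :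
    ∃ d : lp (fun _ : ℤ => ℂ) 2, ‖d‖ ≤ W * ‖c‖ ∧
      ∀ m : ℤ, HasSum (fun l : ℤ => fourierCoeff v l * c (m - l)) (d m) := by
  -- u is the L² function with Fourier coefficients c; the sequence d will consist of the
  -- coefficients of v u.
  set u : Lp ℂ 2 (@AddCircle.haarAddCircle T hT) := fourierBasis.repr.symm c with hu
  have huc : ∀ j, inner ℂ (fourierBasis (T := T) j) u = c j := fun j => by
    rw [← HilbertBasis.repr_apply_apply, hu, LinearIsometryEquiv.apply_symm_apply]
  have hbd : ∀ᵐ x ∂AddCircle.haarAddCircle, ‖v x * u x‖ ≤ W * ‖u x‖ := by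
    filter_upwards [hvW] with x hx
    rw [norm_mul]
    gcongr
  have hvu : MemLp (fun x => v x * u x) 2 (@AddCircle.haarAddCircle T hT) :=
    (Lp.memLp u).of_le_mul (hv.mul (Lp.aestronglyMeasurable u)) hbd
  refine ⟨fourierBasis.repr hvu.toLp, ?_, fun m => ?_⟩
  · rw [LinearIsometryEquiv.norm_map, ← (fourierBasis (T := T)).repr.symm.norm_map c, ← hu]
    refine Lp.norm_le_mul_norm_of_ae_le_mul ?_
    filter_upwards [hbd, hvu.coeFn_toLp] with x hx hx'
    rwa [hx']
  -- Parseval for z = conj(v) e_m against u: ⟨z, u⟩ is the m-th coefficient of v u, while ⟨z,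
  -- e_j⟩⟨e_j, u⟩ = v̂(m-j) c_j. The substitution j = m - l then gives the convolution.
  · have hz : MemLp (fun x => conj (v x) * fourier m x) 2 (@AddCircle.haarAddCircle T hT) := by
      refine MemLp.of_bound ?_ W ?_
      · exact (Complex.continuous_conj.comp_aestronglyMeasurable hv).mul
          (fourier m).continuous.aestronglyMeasurable
      · filter_upwards [hvW] with x hx
        rw [norm_mul, RCLike.norm_conj, fourier_apply, Circle.norm_coe, mul_one]
        exact hx
    have key := fourierBasis.hasSum_inner_mul_inner hz.toLp u
    have hlim : inner ℂ hz.toLp u = fourierBasis.repr hvu.toLp m := by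
      rw [HilbertBasis.repr_apply_apply, L2.inner_def, L2.inner_def]
      refine integral_congr_ae ?_
      filter_upwards [hz.coeFn_toLp, hvu.coeFn_toLp, coeFn_fourierLp 2 m] with x h1 h2 h3
      rw [coe_fourierBasis, h1, h2, h3, RCLike.inner_apply', RCLike.inner_apply']
      simp
      ring
    have hcoef : ∀ j, inner ℂ hz.toLp (fourierBasis (T := T) j) = fourierCoeff v (m - j) := by
      intro j
      rw [L2.inner_def, fourierCoeff]
      refine integral_congr_ae ?_
      filter_upwards [hz.coeFn_toLp, coeFn_fourierLp 2 j] with x h1 h3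
      rw [coe_fourierBasis, h1, h3, RCLike.inner_apply', neg_sub, sub_eq_add_neg, fourier_add,
        fourier_neg]
      simp
      ring
    rw [hlim] at key
    simp only [hcoef, huc] at key
    have := (Equiv.subLeft m).hasSum_iff.2 key
    simpa [Function.comp_def] using this

/-- `fourierCoeffOn` lifts v to the circle of length D - 0, so measurability and the essential bound
are carried from the interval to Haar measure. -/
theorem exists_lp_hasSum_fourierCoeffOn_mul {D : ℝ} (hD : 0 < D) {v : ℝ → ℂ} {W : ℝ} (hW : 0 ≤ W)
    (hv : AEStronglyMeasurable v (volume.restrict (Set.Icc 0 D)))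
    (hvW : ∀ᵐ x ∂volume.restrict (Set.Icc 0 D), ‖v x‖ ≤ W) (c : lp (fun _ : ℤ => ℂ) 2) :
    ∃ d : lp (fun _ : ℤ => ℂ) 2, ‖d‖ ≤ W * ‖c‖ ∧
      ∀ m : ℤ, HasSum (fun l : ℤ => fourierCoeffOn hD v l * c (m - l)) (d m) := by
  have : Fact (0 < D - 0) := ⟨by linarith⟩
  have hI : volume.restrict (Set.Ioc 0 (0 + (D - 0))) = volume.restrict (Set.Icc 0 D) := by
    rw [zero_add, sub_zero]
    exact Measure.restrict_congr_set Ioc_ae_eq_Icc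
  have hmem : MemLp v ∞ (volume.restrict (Set.Ioc 0 (0 + (D - 0)))) := by
    rw [hI]
    exact memLp_top_of_bound hv W hvW
  have hlift := hmem.memLp_liftIoc
  have hmp := AddCircle.measurePreserving_mk (D - 0) 0
  have hE : eLpNorm (AddCircle.liftIoc (D - 0) 0 v) ∞ volume ≤ ENNReal.ofReal W := by
    rw [← eLpNorm_comp_measurePreserving hlift.aestronglyMeasurable hmp]
    rw [eLpNorm_congr_ae (g := v)]
    · rw [hI]
      refine eLpNormEssSup_le_of_ae_bound hvW
    · filter_upwards [ae_restrict_mem measurableSet_Ioc] with x hx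
      exact AddCircle.liftIoc_coe_apply hx
  have hbv : ∀ᵐ x, ‖AddCircle.liftIoc (D - 0) 0 v x‖ ≤ W := by
    filter_upwards [ae_le_eLpNormEssSup (f := AddCircle.liftIoc (D - 0) 0 v)
      (μ := volume)] with x hx
    have := hx.trans hE
    rwa [← ofReal_norm, ENNReal.ofReal_le_ofReal_iff hW] at this
  have hac : (AddCircle.haarAddCircle : Measure (AddCircle (D - 0))) ≪ volume := by
    rw [AddCircle.volume_eq_smul_haarAddCircle]
    exact Measure.absolutelyContinuous_smul (by simpa using hD)
  exact exists_lp_hasSum_fourierCoeff_mul (hlift.aestronglyMeasurable.mono_ac hac)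
    (hac.ae_le hbv) c

/-- The scalar convolution bound applies to each coordinate of the sequence B g, and the squared
norms add up over coordinates. Where `Bhat` takes its default value 0 there is nothing to prove. -/
theorem norm_Bhat_le_of_bound {M : ℕ} {D : ℝ} (hD : 0 < D) {w : ℝ → ℝ → ℂ} {t W : ℝ}
    (hW : 0 ≤ W) (hv : AEStronglyMeasurable (fun x => w x t) (volume.restrict (Set.Icc 0 D)))
    (hvW : ∀ᵐ x ∂volume.restrict (Set.Icc 0 D), ‖w x t‖ ≤ W) (g : ModeSpace M) :
    ‖Bhat hD w t g‖ ≤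
      W * ‖Matrix.toEuclideanCLM (n := Fin (M + 1)) (𝕜 := ℂ) (matB M)‖ * ‖g‖ := by
  set B := Matrix.toEuclideanCLM (n := Fin (M + 1)) (𝕜 := ℂ) (matB M) with hB
  by_cases hg : Memℓp (fun m : ℤ => forceMode hD w t g m) 2
  swap
  · rw [Bhat, dif_neg hg, norm_zero]
    positivity
  have hBg : Memℓp (fun m : ℤ => B (g m)) 2 := by
    refine memℓp_two_of_norm_le (((‖B‖ : ℝ) : ℂ) • g) fun m => ?_
    rw [lp.coeFn_smul, Pi.smul_apply, norm_smul, Complex.norm_real, norm_norm]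
    exact B.le_opNorm _
  set b : ModeSpace M := ⟨_, hBg⟩ with hb
  have hbn : ‖b‖ ≤ ‖B‖ * ‖g‖ := by
    have : ‖b‖ ≤ ‖((‖B‖ : ℝ) : ℂ) • g‖ := by
      refine lp.norm_mono (by norm_num) fun m => ?_
      rw [lp.coeFn_smul, Pi.smul_apply, norm_smul, Complex.norm_real, norm_norm]
      exact B.le_opNorm _
    rwa [norm_smul, Complex.norm_real, norm_norm] at this
  have hc : ∀ i, Memℓp (fun m : ℤ => b m i) 2 := fun i =>
    memℓp_two_of_norm_le b fun m => PiLp.norm_apply_le (b m) i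
  set c : Fin (M + 1) → lp (fun _ : ℤ => ℂ) 2 := fun i => ⟨_, hc i⟩ with hcdef
  choose d hd hsum using fun i => exists_lp_hasSum_fourierCoeffOn_mul hD hW hv hvW (c i)
  have hforce : ∀ m i, forceMode hD w t g m i = d i m := by
    intro m i
    have hs : HasSum (fun l : ℤ => wHat hD w l t • B (g (m - l)))
        (WithLp.toLp 2 fun i => d i m) := by
      have h1 := (Pi.hasSum.2 fun i => hsum i m)
      exact ((PiLp.continuousLinearEquiv 2 ℂ (fun _ : Fin (M + 1) => ℂ)).symm.hasSum).2 h1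
    rw [forceMode, hs.tsum_eq]
  have hsq : ∀ (y : ModeSpace M) (z : Fin (M + 1) → lp (fun _ : ℤ => ℂ) 2),
      (∀ m i, y m i = z i m) → ‖y‖ ^ 2 = ∑ i, ‖z i‖ ^ 2 := by
    intro y z hyz
    refine (hasSum_norm_sq y).unique ?_
    have := hasSum_sum fun i (_ : i ∈ Finset.univ) => hasSum_norm_sq (z i)
    refine this.congr_fun fun m => ?_
    rw [EuclideanSpace.norm_sq_eq]
    simp only [hyz]
  have h1 := hsq (Bhat hD w t g) d fun m i => by
    rw [Bhat, dif_pos hg]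
    exact hforce m i
  have h2 := hsq b c fun m i => rfl
  have h3 : ‖Bhat hD w t g‖ ^ 2 ≤ (W * ‖b‖) ^ 2 := by
    rw [h1, mul_pow, h2, Finset.mul_sum]
    refine Finset.sum_le_sum fun i _ => ?_
    rw [← mul_pow]
    exact pow_le_pow_left₀ (norm_nonneg _) (hd i) 2
  calc ‖Bhat hD w t g‖ ≤ W * ‖b‖ := (pow_le_pow_iff_left₀ (norm_nonneg _) (by positivity) two_ne_zero).1 h3
    _ ≤ W * (‖B‖ * ‖g‖) := by gcongr
    _ = _ := (mul_assoc _ _ _).symm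

/-- For `w ∈ L^∞`, the operators `B̂(t)` are bounded uniformly in almost every `t ≥ 0`. -/
theorem exists_norm_Bhat_le {M : ℕ} {D : ℝ} (hD : 0 < D) {w : ℝ → ℝ → ℂ}
    (hw : MemLp (fun p : ℝ × ℝ => w p.1 p.2) ∞
      (volume.restrict (Set.Icc (0 : ℝ) D ×ˢ Set.Ici (0 : ℝ)))) :
    ∃ C : ℝ, 0 ≤ C ∧ ∀ᵐ t ∂volume.restrict (Set.Ici (0 : ℝ)), ∀ g : ModeSpace M,
      ‖Bhat hD w t g‖ ≤ C * ‖g‖ := by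
  rw [Measure.volume_eq_prod, ← Measure.prod_restrict] at hw
  set W := (eLpNorm (fun p : ℝ × ℝ => w p.1 p.2) ∞
    ((volume.restrict (Set.Icc (0 : ℝ) D)).prod (volume.restrict (Set.Ici (0 : ℝ))))).toReal
  have hbd : ∀ᵐ p ∂(volume.restrict (Set.Icc (0 : ℝ) D)).prod (volume.restrict (Set.Ici (0 : ℝ))),
      ‖w p.1 p.2‖ ≤ W := by
    filter_upwards [ae_le_eLpNormEssSup (f := fun p : ℝ × ℝ => w p.1 p.2)
      (μ := (volume.restrict (Set.Icc (0 : ℝ) D)).prod (volume.restrict (Set.Ici (0 : ℝ))))]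
      with p hp
    have := ENNReal.toReal_mono hw.eLpNorm_ne_top hp
    rwa [toReal_enorm] at this
  -- Fubini is needed with t outermost: for almost every t, a bound for almost every x.
  have hswap := Measure.measurePreserving_swap (μ := volume.restrict (Set.Ici (0 : ℝ)))
    (ν := volume.restrict (Set.Icc (0 : ℝ) D))
  have h1 := Measure.ae_ae_of_ae_prod (hswap.quasiMeasurePreserving.ae hbd)
  have h2 := (hw.aestronglyMeasurable.comp_measurePreserving hswap).prodMk_left
  refine ⟨W * ‖Matrix.toEuclideanCLM (n := Fin (M + 1)) (𝕜 := ℂ) (matB M)‖,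
    mul_nonneg ENNReal.toReal_nonneg (norm_nonneg _), ?_⟩
  filter_upwards [h1, h2] with t ht1 ht2 g
  exact norm_Bhat_le_of_bound hD ENNReal.toReal_nonneg ht2 ht1 g

end FilteredVlasov

/-! ### Gronwall's inequality and decay of the forcing -/

namespace FilteredVlasov

/-- Gronwall's inequality in integral form with an exponentially decaying coefficient: the bound is
uniform in time. -/
theorem add_integral_le_of_le_exp_mul {G : ℝ → ℝ} {a C β : ℝ} (ha : 0 ≤ a) (hC : 0 ≤ C)
    (hβ : 0 < β) (hG0 : ∀ s, 0 ≤ G s) (hG : ∀ t, IntervalIntegrable G volume 0 t)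
    (hle : ∀ᵐ s ∂volume.restrict (Set.Ioi (0 : ℝ)),
      G s ≤ C * Real.exp (-β * s) * (a + ∫ r in (0 : ℝ)..s, G r)) {t : ℝ} (ht : 0 ≤ t) :
    a + ∫ s in (0 : ℝ)..t, G s ≤ a * Real.exp (C / β) := by
  set ψ : ℝ → ℝ := fun t => a + ∫ s in (0 : ℝ)..t, G s with hψ
  have hψc : Continuous ψ := continuous_const.add
    (intervalIntegral.continuous_primitive (fun x y => (hG x).symm.trans (hG y)) 0)
  have hψ0 : ∀ s, 0 ≤ s → 0 ≤ ψ s := fun s hs =>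
    add_nonneg ha (intervalIntegral.integral_nonneg hs fun r _ => hG0 r)
  set k : ℝ → ℝ := fun s => C * Real.exp (-β * s) * ψ s with hk
  have hkc : Continuous k := by fun_prop
  -- The inequality for G holds only almost everywhere, so ψ need not be differentiable everywhere.
  -- It is majorized by R, which has the continuous derivative k.
  set R : ℝ → ℝ := fun t => a + ∫ s in (0 : ℝ)..t, k s with hR
  have hψR : ∀ s, 0 ≤ s → ψ s ≤ R s := by
    intro s hs
    refine add_le_add_right ?_ a
    refine intervalIntegral.integral_mono_ae_restrict hs (hG s) (hkc.intervalIntegrable _ _) ?_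
    have : ∀ᵐ r ∂volume.restrict (Set.Icc 0 s), r ∈ Set.Ioi (0 : ℝ) := by
      rw [← Measure.restrict_congr_set (Ioc_ae_eq_Icc (μ := volume) (a := (0 : ℝ)) (b := s))]
      filter_upwards [ae_restrict_mem measurableSet_Ioc] with r hr using hr.1
    rw [ae_restrict_iff' measurableSet_Ioi] at hle
    filter_upwards [this, ae_restrict_of_ae hle] with r hr hr' using hr' hr
  have hRd : ∀ s, HasDerivAt R (k s) s := fun s =>
    ((hkc.integral_hasStrictDerivAt 0 s).hasDerivAt).const_add a
  -- The integrating factor exp((C/β) e^{-βs}) equals e^{C/β} at s = 0 and never falls below 1,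
  -- which yields the constant e^{C/β}. The derivative of the product has the sign of ψ - R ≤ 0.
  have hZd : ∀ s, HasDerivAt (fun s => R s * Real.exp (C / β * Real.exp (-β * s)))
      (k s * Real.exp (C / β * Real.exp (-β * s)) + R s *
        (Real.exp (C / β * Real.exp (-β * s)) * (C / β * (Real.exp (-β * s) * (-β * 1))))) s :=
    fun s => (hRd s).mul ((((hasDerivAt_id s).const_mul (-β)).exp.const_mul (C / β)).exp)
  have hanti : AntitoneOn (fun s => R s * Real.exp (C / β * Real.exp (-β * s))) (Set.Ici 0) := by
    refine antitoneOn_of_deriv_nonpos (convex_Ici 0)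
      (fun s _ => (hZd s).continuousAt.continuousWithinAt)
      (fun s _ => (hZd s).differentiableAt.differentiableWithinAt) fun s hs => ?_
    rw [interior_Ici] at hs
    rw [(hZd s).deriv]
    have : k s * Real.exp (C / β * Real.exp (-β * s)) + R s *
        (Real.exp (C / β * Real.exp (-β * s)) * (C / β * (Real.exp (-β * s) * (-β * 1)))) =
        -(C * Real.exp (-β * s) * Real.exp (C / β * Real.exp (-β * s)) * (R s - ψ s)) := by
      simp only [hk]
      field_simp
      ring
    rw [this]
    have := sub_nonneg.2 (hψR s hs.le)
    exact neg_nonpos.2 (by positivity)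
  have hZ := hanti Set.self_mem_Ici ht ht
  have hR0 : R 0 = a := by simp [hR]
  simp only [hR0, mul_zero, Real.exp_zero, mul_one] at hZ
  refine (hψR t ht).trans (le_trans ?_ hZ)
  exact le_mul_of_one_le_right ((hψ0 t ht).trans (hψR t ht)) (Real.one_le_exp (by positivity))

variable {M : ℕ} {D : ℝ} (hD : 0 < D) (h : Fin (M + 1) → ℝ) (α : ℝ → ℝ) (w : ℝ → ℝ → ℂ)

/-- The forcing term `exp(-α(s)) B̂(s) f(s)`. -/
noncomputable def forcing (f : ℝ → ModeSpace M) (s : ℝ) : ModeSpace M :=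
  ((Real.exp (-α s) : ℝ) : ℂ) • Bhat hD w s (f s)

variable {h α w} {f : ℝ → ModeSpace M}

theorem duhamelIntegrand_eq (t s : ℝ) :
    duhamelIntegrand hD h α w f t s = expAhat D h (t - s) (forcing hD α w f s) :=
  (expAhat_smul D h (t - s) _ _).symm

variable {hD}

/-- The blocks are invertible, so the forcing is recovered from the integrable Duhamel integrand by
e^{-(t-s)Â}. Its measurability thus needs no separate study of w or f. -/
theorem IsMildSolution.integrableOn_forcing (hf : IsMildSolution hD h α w f) {t : ℝ}
    (ht : 0 ≤ t) : IntegrableOn (forcing hD α w f) (Set.Ioc 0 t) := by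
  have hF : IntegrableOn (duhamelIntegrand hD h α w f t) (Set.Ioc 0 t) :=
    (intervalIntegrable_iff_integrableOn_Ioc_of_le ht).1 (hf t ht).1
  have heq : ∀ s, forcing hD α w f s =
      expAhat D h (-(t - s)) (duhamelIntegrand hD h α w f t s) := fun s => by
    rw [duhamelIntegrand_eq, expAhat_neg_expAhat]
  have hm : AEStronglyMeasurable (forcing hD α w f) (volume.restrict (Set.Ioc 0 t)) := by
    rw [funext heq]
    exact aestronglyMeasurable_expAhat D h hF.aestronglyMeasurable (by fun_prop)
  refine (hF.norm.const_mul (Real.exp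
    (‖Matrix.toEuclideanCLM (n := Fin (M + 1)) (𝕜 := ℂ) (matH h)‖ * t))).mono' hm ?_
  filter_upwards [ae_restrict_mem measurableSet_Ioc] with s hs
  rw [heq]
  refine (norm_expAhat_le D h _ _).trans ?_
  have : |-(t - s)| ≤ t := by
    rw [abs_neg, abs_of_nonneg (by linarith [hs.2])]
    linarith [hs.1]
  gcongr

theorem IsMildSolution.norm_le_add_integral (hf : IsMildSolution hD h α w f)
    (h_nonpos : ∀ i, h i ≤ 0) {t : ℝ} (ht : 0 ≤ t) :
    ‖f t‖ ≤ ‖f 0‖ + ∫ s in (0 : ℝ)..t, ‖forcing hD α w f s‖ := by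
  rw [(hf t ht).2]
  refine (norm_add_le _ _).trans (add_le_add (norm_expAhat_le_of_nonneg D h h_nonpos ht _) ?_)
  refine intervalIntegral.norm_integral_le_of_norm_le ht ?_
    ((intervalIntegrable_iff_integrableOn_Ioc_of_le ht).2 (hf.integrableOn_forcing ht).norm)
  refine Eventually.of_forall fun s hs => ?_
  rw [duhamelIntegrand_eq]
  exact norm_expAhat_le_of_nonneg D h h_nonpos (sub_nonneg.2 hs.2) _

/-- The forcing term of a mild solution decays exponentially. -/
theorem IsMildSolution.exists_norm_forcing_le (hf : IsMildSolution hD h α w f)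
    (h_nonpos : ∀ i, h i ≤ 0) {αE : ℝ} (hαE : 0 < αE) (hα : ∀ t : ℝ, 0 < t → αE * t ≤ α t)
    (hw : MemLp (fun p : ℝ × ℝ => w p.1 p.2) ∞
      (volume.restrict (Set.Icc (0 : ℝ) D ×ˢ Set.Ici (0 : ℝ)))) :
    ∃ K : ℝ, ∀ᵐ s ∂volume.restrict (Set.Ioi (0 : ℝ)),
      ‖forcing hD α w f s‖ ≤ K * Real.exp (-αE * s) := by
  obtain ⟨C, hC, hB⟩ := exists_norm_Bhat_le (M := M) hD hw
  have hB' : ∀ᵐ s ∂volume.restrict (Set.Ioi (0 : ℝ)),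
      ‖forcing hD α w f s‖ ≤ C * Real.exp (-αE * s) * ‖f s‖ := by
    filter_upwards [ae_restrict_of_ae_restrict_of_subset Set.Ioi_subset_Ici_self hB,
      ae_restrict_mem measurableSet_Ioi] with s hs hs0
    rw [forcing, norm_smul, Complex.norm_real, Real.norm_eq_abs, Real.abs_exp]
    have h1 : Real.exp (-α s) ≤ Real.exp (-αE * s) :=
      Real.exp_le_exp.2 (by linarith [hα s hs0])
    calc _ ≤ Real.exp (-αE * s) * (C * ‖f s‖) := by
          gcongr
          exact hs (f s)
      _ = _ := by ring
  -- Gronwall asks for integrability up to every real t, but a mild solution is unconstrained at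
  -- negative times; the indicator removes them.
  set G : ℝ → ℝ := (Set.Ioi 0).indicator fun s => ‖forcing hD α w f s‖
  have hGi : ∀ s, 0 ≤ s → ∫ r in (0 : ℝ)..s, G r = ∫ r in (0 : ℝ)..s, ‖forcing hD α w f r‖ := by
    intro s hs
    refine intervalIntegral.integral_congr_ae (Eventually.of_forall fun r hr => ?_)
    rw [Set.uIoc_of_le hs] at hr
    exact Set.indicator_of_mem hr.1 _
  have hbound : ∀ s, 0 ≤ s → ‖f s‖ ≤ ‖f 0‖ * Real.exp (C / αE) := by
    intro s hs
    refine (hf.norm_le_add_integral h_nonpos hs).trans ?_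
    rw [← hGi s hs]
    refine add_integral_le_of_le_exp_mul (norm_nonneg _) hC hαE
      (Set.indicator_nonneg fun _ _ => norm_nonneg _) (fun t => ?_) ?_ hs
    · rcases le_total 0 t with ht | ht
      · refine (intervalIntegrable_iff_integrableOn_Ioc_of_le ht).2 ?_
        exact (hf.integrableOn_forcing ht).norm.indicator measurableSet_Ioi
      · refine IntervalIntegrable.symm ?_
        refine (intervalIntegrable_iff_integrableOn_Ioc_of_le ht).2 ?_
        refine integrableOn_zero.congr_fun (fun r hr => ?_) measurableSet_Ioc
        exact (Set.indicator_of_notMem (not_lt.2 hr.2) _).symm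
    · filter_upwards [hB', ae_restrict_mem measurableSet_Ioi] with r hr hr0
      rw [hGi r (le_of_lt hr0), Set.indicator_of_mem hr0]
      refine hr.trans ?_
      gcongr
      exact hf.norm_le_add_integral h_nonpos (le_of_lt hr0)
  refine ⟨C * (‖f 0‖ * Real.exp (C / αE)), ?_⟩
  filter_upwards [hB', ae_restrict_mem measurableSet_Ioi] with r hr hr0
  refine hr.trans ?_
  rw [mul_right_comm]
  gcongr
  exact hbound r (le_of_lt hr0)

end FilteredVlasov

/-! ### Passage to the limit in Duhamel's formula -/

open FilteredVlasov

theorem mainTheorem5 (M : ℕ) (D : ℝ) (hD : 0 < D)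
    -- the filter: nonpositive diagonal entries, the first zero, the last strictly negative
    (h : Fin (M + 1) → ℝ) (h_nonpos : ∀ i, h i ≤ 0) (h_first : h 0 = 0)
    (h_last : h (Fin.last M) < 0)
    -- the force `E(x,t) = exp(-α(t)) w(x,t)` with `w ∈ L^∞([0,D] × [0,∞))`
    (αE : ℝ) (hαE : 0 < αE) (α : ℝ → ℝ) (hα : ∀ t : ℝ, 0 < t → αE * t ≤ α t)
    (w : ℝ → ℝ → ℂ)
    (hw : MemLp (fun p : ℝ × ℝ => w p.1 p.2) ∞
      (volume.restrict (Set.Icc (0 : ℝ) D ×ˢ Set.Ici (0 : ℝ))))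
    (f : ℝ → FilteredVlasov.ModeSpace M) (hf : FilteredVlasov.IsMildSolution hD h α w f) :
    ∃ fInf : FilteredVlasov.ModeSpace M,
      Tendsto (fun t : ℝ => ‖f t - fInf‖) atTop (𝓝 0) ∧
      ∀ m : ℤ, m ≠ 0 → fInf m = 0 := by
  obtain ⟨K, hK⟩ := hf.exists_norm_forcing_le h_nonpos hαE hα hw
  choose P hP hP0 using exists_tendsto_expAhat (M := M) hD h_nonpos h_last
  refine ⟨P (f 0) + ∫ s in Set.Ioi (0 : ℝ), P (forcing hD α w f s), ?_, fun m hm => ?_⟩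
  · rw [← tendsto_iff_norm_sub_tendsto_zero]
    -- The indicator moves all integrals to the fixed domain (0,∞), with dominating function K
    -- e^{-α_E s}. For fixed s the integrand tends to P F(s) because t - s → ∞.
    have hint : Tendsto (fun t : ℝ => ∫ s in Set.Ioi (0 : ℝ),
        (Set.Ioc 0 t).indicator (duhamelIntegrand hD h α w f t) s) atTop
        (𝓝 (∫ s in Set.Ioi (0 : ℝ), P (forcing hD α w f s))) := by
      refine tendsto_integral_filter_of_dominated_convergence
        (fun s => K * Real.exp (-αE * s)) ?_ ?_ ?_ ?_
      · filter_upwards [eventually_ge_atTop 0] with t ht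
        have := ((intervalIntegrable_iff_integrableOn_Ioc_of_le ht).1 (hf t ht).1)
        exact ((integrable_indicator_iff measurableSet_Ioc).2 this).aestronglyMeasurable.restrict
      · filter_upwards with t
        filter_upwards [hK] with s hs
        refine le_trans ?_ hs
        by_cases hst : s ∈ Set.Ioc 0 t
        · rw [Set.indicator_of_mem hst, duhamelIntegrand_eq]
          exact norm_expAhat_le_of_nonneg D h h_nonpos (sub_nonneg.2 hst.2) _
        · rw [Set.indicator_of_notMem hst, norm_zero]
          exact norm_nonneg _
      · exact (integrableOn_exp_mul_Ioi (neg_lt_zero.2 hαE) 0).const_mul K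
      · filter_upwards [ae_restrict_mem measurableSet_Ioi] with s hs
        refine ((hP (forcing hD α w f s)).comp (tendsto_atTop_add_const_right _ (-s)
          tendsto_id)).congr' ?_
        filter_upwards [eventually_ge_atTop s] with t hst
        rw [Set.indicator_of_mem (show s ∈ Set.Ioc 0 t from ⟨hs, hst⟩), duhamelIntegrand_eq]
        rfl
    refine ((hP (f 0)).add hint).congr' ?_
    filter_upwards [eventually_ge_atTop 0] with t ht
    rw [(hf t ht).2, intervalIntegral.integral_of_le ht, setIntegral_indicator measurableSet_Ioc,
      Set.inter_eq_self_of_subset_right fun s hs => hs.1]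
  · have hI : (∫ s in Set.Ioi (0 : ℝ), P (forcing hD α w f s)) m = 0 := by
      -- Integrability of P F need not be settled: without it the Bochner integral is 0 by
      -- convention, and its m-th mode is 0 as well.
      by_cases hi : IntegrableOn (fun s => P (forcing hD α w f s)) (Set.Ioi 0)
      · have := (lp.evalCLM ℂ (fun _ : ℤ => Coeff M) 2 m).integral_comp_comm hi
        refine this.symm.trans ?_
        refine integral_eq_zero_of_ae (Eventually.of_forall fun s => ?_)
        exact hP0 _ m hm
      · rw [integral_undef hi]
        rfl
    rw [lp.coeFn_add, Pi.add_apply, hP0 _ m hm, hI, add_zero]
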